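/- Let $0<\alpha<1$ be irrational and let $Tx=x+\alpha \bmod 1$ be the rotation of angle $\alpha$ on $I=[0,1)$. Let $N\ge 2$ be an integer, let $a_1,a_2\in\mathbb Z$, let $0<\zeta_1<1$, and let $f:I\to\mathbb Z/N\mathbb Z$ take the value $a_1$ on $[0,\zeta_1)$ and the value $a_2$ on $[\zeta_1,1)$ (both modulo $N$). Let $T_f:I\times\mathbb Z/N\mathbb Z\to I\times\mathbb Z/N\mathbb Z$ be defined by $T_f(x,s)=(Tx,\,s+f(x))$. We say that $T_f$ is minimal if every orbit $\{T_f^n(x,s): n\ge 0\}$ is dense in $I\times\mathbb Z/N\mathbb Z$ (usual topology on $I$, discrete topology on $\mathbb Z/N\mathbb Z$), and write $(a,b,c)$ for the greatest common divisor of $a,b,c$. Let $m$ be an integer. Then: (i) if $\zeta_1=m\alpha$, then $T_f$ is minimal if and only if $(N,\,ma_1,\,a_2)=1$; (ii) if $\zeta_1=1-m\alpha$, then $T_f$ is minimal if and only if $(N,\,a_1,\,ma_2)=1$; (iii) if $\zeta_1=m\alpha-m+1$, then $T_f$ is minimal if and only if $(N,\,a_1,\,ma_2)=1$; (iv) if $\zeta_1=m-m\alpha$,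 then $T_f$ is minimal if and only if $(N,\,ma_1,\,a_2)=1$; (v) if $\zeta_1=2-m\alpha$, $m\ge 2$ and $\alpha<\frac1{m-1}$, then $T_f$ is minimal if and only if $(N,\,a_2+(m-2)a_1,\,ma_1)=1$; (vi) if $\zeta_1=m\alpha-1$, $m\ge 2$ and $\alpha<\frac1{m-1}$, then $T_f$ is minimal if and only if $(N,\,a_1+(m-2)a_2,\,ma_2)=1$. -/

import Mathlib

namespace VeechExt

/-- The half-open unit interval `I = [0,1[`, with the topology induced from `ℝ`. -/
abbrev I : Type := Set.Ico (0 : ℝ) 1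

/-- The rotation `x ↦ x + α` modulo `1` on `[0,1[`. -/
noncomputable def rotation (α : ℝ) (x : I) : I :=
  ⟨Int.fract ((x : ℝ) + α), Int.fract_nonneg _, Int.fract_lt_one _⟩

/-- For `0 < α < 1` the rotation is the exchange of the two intervals `[0, 1 - α[` and
`[1 - α, 1[`. -/
theorem rotation_eq_exchange {α : ℝ} (h0 : 0 < α) (h1 : α < 1) (x : I) :
    (rotation α x : ℝ) = if (x : ℝ) < 1 - α then (x : ℝ) + α else (x : ℝ) + α - 1 := by
  obtain ⟨x, hx0, hx1⟩ := x
  simp only [rotation]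
  split_ifs with h
  · exact Int.fract_eq_self.2 ⟨by linarith, by linarith⟩
  · rw [← Int.fract_sub_one]
    exact Int.fract_eq_self.2 ⟨by linarith, by linarith⟩

/-- The function on `[0,1[` with values in `ℤ/Nℤ` equal to `a₁` on `[0, ζ[` and to `a₂`
on `[ζ, 1[`. -/
noncomputable def stepFun (N : ℕ) (ζ : ℝ) (a₁ a₂ : ℤ) (x : I) : ZMod N :=
  if (x : ℝ) < ζ then (a₁ : ZMod N) else (a₂ : ZMod N)

/-- The extension `T_f (x, s) = (T x, s + f x)` of `T` by `f : I → ℤ/Nℤ`. -/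
def extension {N : ℕ} (T : I → I) (f : I → ZMod N) : I × ZMod N → I × ZMod N :=
  fun p => (T p.1, p.2 + f p.1)

/-- A transformation of a topological space is minimal if every orbit `{T^n x, n ≥ 0}`
is dense. -/
def IsMinimal {X : Type*} [TopologicalSpace X] (T : X → X) : Prop :=
  ∀ x : X, Dense (Set.range fun n : ℕ => T^[n] x)

/-- The extension of the rotation of angle `α` by the function with values `a₁` on `[0, ζ[`
and `a₂` on `[ζ, 1[`. -/
noncomputable def rotationExtension (N : ℕ) (α ζ : ℝ) (a₁ a₂ : ℤ) :
    I × ZMod N → I × ZMod N :=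
  extension (rotation α) (stepFun N ζ a₁ a₂)

/-- The integers `a`, `b`, `c` are globally coprime, i.e. `(a, b, c) = 1`. -/
def Coprime₃ (a b c : ℤ) : Prop := Int.gcd a (Int.gcd b c) = 1

end VeechExt

open Filter Topology

namespace VeechExt

/-! In all six cases `ζ = p + qα` with integers `p`, `q`. Up to a coboundary with right locally
constant transfer function, `f` is `c + d⌊x + α⌋` (`exists_transfer`), so its `n`-th Birkhoff sum is
`nc + d⌊x + nα⌋` plus a boundary term (`extension_iterate`). Returns near `0` therefore shift the
fibre only by combinations of `c` and `d`, which forces `(N, c, d) = 1`. Conversely, irrationality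
lets one prescribe `n` and `⌊x + nα⌋` modulo `N` together with an approximate position, so every
fibre value is reached (`isMinimal_extension_iff`). -/

theorem exists_nat_int_mem_Ioo {α : ℝ} (hα : Irrational α) {N : ℕ} (hN : 0 < N)
    (x : ℝ) {a b : ℝ} (hab : a < b) :
    ∃ (k : ℕ) (l : ℤ), x + k * (N * α) - l * N ∈ Set.Ioo a b := by
  have hN' : (0 : ℝ) < N := by exact_mod_cast hN
  have : Fact ((0 : ℝ) < N) := ⟨hN'⟩
  have hd : DenseRange (fun k : ℕ => k • (((N * α : ℝ)) : AddCircle (N : ℝ))) := by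
    rw [← denseRange_zsmul_iff_nsmul]
    rw [AddCircle.denseRange_zsmul_coe_iff, mul_div_cancel_left₀ _ hN'.ne']
    exact hα
  have hU : IsOpen ((fun y : ℝ => (y : AddCircle (N : ℝ))) '' Set.Ioo (a - x) (b - x)) :=
    QuotientAddGroup.isOpenMap_coe _ isOpen_Ioo
  obtain ⟨k, y, hy, hyk⟩ := hd.exists_mem_open hU
    (Set.Nonempty.image _ (Set.nonempty_Ioo.2 (by linarith)))
  have h : ((y : ℝ) : AddCircle (N : ℝ)) = ((k * (N * α) : ℝ) : AddCircle (N : ℝ)) := by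
    rw [← nsmul_eq_mul k]
    exact hyk
  rw [QuotientAddGroup.eq] at h
  obtain ⟨l, hl⟩ := AddSubgroup.mem_zmultiples_iff.1 h
  rw [zsmul_eq_mul] at hl
  exact ⟨k, l, by linarith [hy.1], by linarith [hy.2]⟩

theorem coe_iterate_rotation (α : ℝ) (n : ℕ) (x : I) :
    ((rotation α)^[n] x : ℝ) = Int.fract ((x : ℝ) + n * α) := by
  induction n with
  | zero => simpa using (Int.fract_eq_self.2 ⟨x.2.1, x.2.2⟩).symm
  | succ n ih =>
    rw [Function.iterate_succ_apply']
    simp only [rotation, ih]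
    rw [Int.fract_eq_fract]
    exact ⟨-⌊(x : ℝ) + n * α⌋, by push_cast [Int.fract]; ring⟩

/-- The orbits of an extension by a cocycle that is cohomologous to `x ↦ c + d * ⌊x + α⌋`. -/
theorem extension_iterate {α : ℝ} {N : ℕ} {f : I → ZMod N} {c d e : ZMod N} {H : ℝ → ℤ}
    (hf : ∀ x : I, f x = c + d * (⌊(x : ℝ) + α⌋ : ℤ) + e * (H (rotation α x) - H x : ℤ))
    (n : ℕ) (p : I × ZMod N) :
    (extension (rotation α) f)^[n] p = ((rotation α)^[n] p.1,
      p.2 + n * c + d * (⌊(p.1 : ℝ) + n * α⌋ : ℤ) +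
        e * (H ((rotation α)^[n] p.1 : I) - H p.1 : ℤ)) := by
  induction n with
  | zero =>
    have h : ⌊(p.1 : ℝ)⌋ = 0 := Int.floor_eq_zero_iff.2 p.1.2
    simp [h]
  | succ n ih =>
    rw [Function.iterate_succ_apply', ih, Function.iterate_succ_apply']
    refine Prod.ext rfl ?_
    simp only [extension]
    have h : ⌊(p.1 : ℝ) + (n + 1 : ℕ) * α⌋ =
        ⌊(p.1 : ℝ) + n * α⌋ + ⌊((rotation α)^[n] p.1 : ℝ) + α⌋ := by
      rw [coe_iterate_rotation, ← Int.floor_intCast_add]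
      congr 1
      push_cast [Int.fract]
      ring
    rw [hf, h]
    push_cast
    ring

theorem coprime₃_iff {a b c : ℤ} :
    Coprime₃ a b c ↔ ∀ k : ℤ, k ∣ a → k ∣ b → k ∣ c → k ∣ 1 := by
  unfold Coprime₃
  constructor
  · intro h k ha hb hc
    have := Int.dvd_coe_gcd ha (Int.dvd_coe_gcd hb hc)
    rwa [h] at this
  · intro h
    have h2 : ((Int.gcd b c : ℕ) : ℤ) ∣ b := Int.gcd_dvd_left ..
    have h3 : ((Int.gcd b c : ℕ) : ℤ) ∣ c := Int.gcd_dvd_right ..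
    have h1 := Int.gcd_dvd_right a (Int.gcd b c)
    have := h (Int.gcd a (Int.gcd b c)) (Int.gcd_dvd_left ..) (h1.trans h2) (h1.trans h3)
    exact Nat.dvd_one.1 (by exact_mod_cast this)

theorem Coprime₃.exists_mul_add_mul_eq {N : ℕ} [NeZero N] {c d : ℤ} (h : Coprime₃ N c d)
    (w : ZMod N) : ∃ (r : ℕ) (t : ℤ), (r * c + d * t : ZMod N) = w := by
  unfold Coprime₃ at h
  have h1 := Int.gcd_eq_gcd_ab (N : ℤ) (Int.gcd c d)
  generalize Int.gcdB (N : ℤ) (Int.gcd c d) = u at h1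
  rw [h, mul_comm _ u, Int.gcd_eq_gcd_ab c d] at h1
  have h2 := congrArg (Int.cast : ℤ → ZMod N) h1
  push_cast at h2
  rw [ZMod.natCast_self] at h2
  refine ⟨(w * u * (Int.gcdA c d : ℤ) : ZMod N).val,
    w.val * u * Int.gcdB c d, ?_⟩
  push_cast
  rw [ZMod.natCast_zmod_val, ZMod.natCast_zmod_val]
  linear_combination (-w) * h2

/-- Minimality of an extension of an irrational rotation by a cocycle that is cohomologous to
`x ↦ c + d * ⌊x + α⌋`, with a transfer function that is locally constant on the right. -/
theorem isMinimal_extension_iff {α : ℝ} (hα : Irrational α) {N : ℕ} (hN : 0 < N)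
    {f : I → ZMod N} {c d : ℤ} {e : ZMod N} {H : ℝ → ℤ}
    (hH : ∀ x, ∀ᶠ y in 𝓝[≥] x, H y = H x)
    (hf : ∀ x : I, f x = c + d * (⌊(x : ℝ) + α⌋ : ℤ) + e * (H (rotation α x) - H x : ℤ)) :
    IsMinimal (extension (rotation α) f) ↔ Coprime₃ N c d := by
  have : NeZero N := ⟨hN.ne'⟩
  constructor
  · intro hmin
    rw [coprime₃_iff]
    intro k hkN hkc hkd
    -- Since `0` is the left end of `I`, one-sided constancy of `H` holds on a full neighbourhood,
    -- where the boundary term vanishes.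
    obtain ⟨u, hu, hu'⟩ := mem_nhdsGE_iff_exists_Ico_subset.1 (hH 0)
    let z : I := ⟨0, le_rfl, one_pos⟩
    have hopen : IsOpen ({x : I | (x : ℝ) < u} ×ˢ ({1} : Set (ZMod N))) :=
      (isOpen_lt continuous_subtype_val continuous_const).prod (isOpen_discrete _)
    obtain ⟨_, ⟨n, rfl⟩, hn⟩ := (hmin (z, 0)).exists_mem_open hopen ⟨(z, 1), hu, rfl⟩
    simp only [extension_iterate hf] at hn
    obtain ⟨hn1, hn2⟩ := hn
    have hHz : H ((rotation α)^[n] z : I) = H (z : ℝ) := hu' ⟨((rotation α)^[n] z).2.1, hn1⟩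
    simp only [hHz, Set.mem_singleton_iff] at hn2
    have h1 : ((n * c + d * ⌊(z : ℝ) + n * α⌋ : ℤ) : ZMod N) = (1 : ℤ) := by
      push_cast at hn2 ⊢
      linear_combination hn2
    have h2 := hkN.trans ((ZMod.intCast_eq_intCast_iff_dvd_sub _ _ _).1 h1)
    have h3 : k ∣ n * c + d * ⌊(z : ℝ) + n * α⌋ :=
      dvd_add (hkc.mul_left _) (hkd.mul_right _)
    simpa using dvd_add h2 h3
  · rintro hcop ⟨x, s⟩
    rw [dense_iff_inter_open]
    rintro U hU ⟨⟨y, w⟩, hy⟩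
    have hUy : {y' : I | (y', w) ∈ U} ∈ 𝓝 y :=
      (hU.preimage (by fun_prop : Continuous fun y' : I => (y', w))).mem_nhds hy
    obtain ⟨V, hV, hVU⟩ := mem_nhds_subtype _ _ _ |>.1 hUy
    obtain ⟨u, hu, hu'⟩ := mem_nhdsGE_iff_exists_Ico_subset.1
      (inter_mem (mem_nhdsWithin_of_mem_nhds hV) (inter_mem (hH y) (Ico_mem_nhdsGE y.2.2)))
    obtain ⟨r, t, hrt⟩ := hcop.exists_mul_add_mul_eq (w - s - e * (H y - H x : ℤ))
    obtain ⟨k, l, hkl⟩ := exists_nat_int_mem_Ioo hα hN (x + r * α)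
      -- Shifting the target by `t` modulo `N` makes the floor congruent to `t`; steps by multiples
      -- of `N` keep `n` congruent to `r`.
      (add_lt_add_right (Set.mem_Ioi.1 hu) (t : ℝ))
    set v : ℝ := x + r * α + k * (N * α) - l * N - t with hv
    have hv1 : v ∈ Set.Ico (y : ℝ) u := ⟨by linarith [hkl.1], by linarith [hkl.2]⟩
    obtain ⟨hvV, hvH, -, hv2⟩ := hu' hv1
    have hv0 : 0 ≤ v := y.2.1.trans hv1.1
    have hxn : (x : ℝ) + (r + k * N : ℕ) * α = (t + l * N : ℤ) + v := by
      rw [hv]; push_cast; ring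
    have hfl : ⌊(x : ℝ) + (r + k * N : ℕ) * α⌋ = t + l * N := by
      rw [hxn, Int.floor_intCast_add, Int.floor_eq_zero_iff.2 ⟨hv0, hv2⟩, add_zero]
    have hfr : ((rotation α)^[r + k * N] x : ℝ) = v := by
      rw [coe_iterate_rotation, hxn, Int.fract_intCast_add, Int.fract_eq_self.2 ⟨hv0, hv2⟩]
    refine ⟨_, ?_, r + k * N, rfl⟩
    simp only [extension_iterate hf, hfl, hfr]
    have hvH' : H v = H y := hvH
    have hw : s + ((r + k * N : ℕ) : ZMod N) * c + d * ((t + l * N : ℤ) : ZMod N) +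
        e * ((H v - H x : ℤ) : ZMod N) = w := by
      rw [hvH']
      push_cast at hrt ⊢
      rw [ZMod.natCast_self]
      linear_combination hrt
    rw [hw]
    exact hVU (show ((rotation α)^[r + k * N] x : ℝ) ∈ V by rwa [hfr])

theorem eventually_floor_sub_eq (a x : ℝ) : ∀ᶠ y in 𝓝[≥] x, ⌊y - a⌋ = ⌊x - a⌋ := by
  have h : x < a + ⌊x - a⌋ + 1 := by linarith [Int.lt_floor_add_one (x - a)]
  filter_upwards [Ico_mem_nhdsGE h] with y hy
  rw [Int.floor_eq_iff]
  constructor <;> linarith [hy.1, hy.2, Int.floor_le (x - a)]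

/-- The rotation subtracts the integer `⌊x + α⌋`. Hence moving a discontinuity from `a` to `a - α`
adds `⌊x + α⌋` up to a coboundary. -/
theorem floor_rotation_sub (α a : ℝ) (x : I) :
    ⌊(rotation α x : ℝ) - a⌋ = ⌊(x : ℝ) - (a - α)⌋ - ⌊(x : ℝ) + α⌋ := by
  rw [← Int.floor_sub_intCast]
  congr 1
  simp only [rotation, Int.fract]
  ring

/-- The function `x ↦ ⌊x - q * α⌋` is cohomologous to `x ↦ -q * ⌊x + α⌋`. -/
theorem exists_transfer (α : ℝ) (q : ℤ) :
    ∃ H : ℝ → ℤ, (∀ x, ∀ᶠ y in 𝓝[≥] x, H y = H x) ∧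
      ∀ x : I, ⌊(x : ℝ) - q * α⌋ = -q * ⌊(x : ℝ) + α⌋ + (H (rotation α x) - H x) := by
  induction q using Int.induction_on with
  | zero =>
    refine ⟨fun _ => 0, fun x => by simp, fun x => ?_⟩
    simp
  | succ q ih =>
    obtain ⟨H, hH, hHx⟩ := ih
    refine ⟨fun x => H x - ⌊x - ((q : ℤ) + 1 : ℤ) * α⌋, fun x => ?_, fun x => ?_⟩
    · filter_upwards [hH x, eventually_floor_sub_eq (((q : ℤ) + 1 : ℤ) * α) x] with y h1 h2
      rw [h1, h2]
    · have h := hHx x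
      simp only [floor_rotation_sub]
      rw [show ((((q : ℤ) + 1 : ℤ) : ℝ) * α - α) = ((q : ℤ) : ℝ) * α by push_cast; ring]
      linear_combination h
  | pred q ih =>
    obtain ⟨H, hH, hHx⟩ := ih
    refine ⟨fun x => H x + ⌊x - (-(q : ℤ) : ℤ) * α⌋, fun x => ?_, fun x => ?_⟩
    · filter_upwards [hH x, eventually_floor_sub_eq ((-(q : ℤ) : ℤ) * α) x] with y h1 h2
      rw [h1, h2]
    · have h := hHx x
      simp only [floor_rotation_sub]
      rw [show (((-(q : ℤ) : ℤ) : ℝ) * α - α) = ((-(q : ℤ) - 1 : ℤ) : ℝ) * α by push_cast; ring]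
      linear_combination h

theorem stepFun_eq {ζ : ℝ} (hζ0 : 0 < ζ) (hζ1 : ζ < 1) (N : ℕ) (a₁ a₂ : ℤ) (x : I) :
    stepFun N ζ a₁ a₂ x = ((a₁ + (a₂ - a₁) * (⌊(x : ℝ) - ζ⌋ + 1) : ℤ) : ZMod N) := by
  have hx := x.2
  unfold stepFun
  split_ifs with h
  · have : ⌊(x : ℝ) - ζ⌋ = -1 := by
      rw [Int.floor_eq_iff]; constructor <;> push_cast <;> linarith [hx.1]
    rw [this]; simp
  · have : ⌊(x : ℝ) - ζ⌋ = 0 := by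
      rw [Int.floor_eq_zero_iff]; constructor <;> linarith [hx.2]
    rw [this]; simp

/-- The criterion for a discontinuity `ζ = p + q * α` on the orbit of `0`. -/
theorem isMinimal_rotationExtension_iff {α : ℝ} (hα : Irrational α) {N : ℕ} (hN : 0 < N)
    (a₁ a₂ : ℤ) {ζ : ℝ} (hζ0 : 0 < ζ) (hζ1 : ζ < 1) {p q : ℤ} (hζ : ζ = p + q * α) :
    IsMinimal (rotationExtension N α ζ a₁ a₂) ↔
      Coprime₃ N (a₁ + (1 - p) * (a₂ - a₁)) (q * (a₂ - a₁)) := by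
  obtain ⟨H, hH, hHx⟩ := exists_transfer α (q : ℤ)
  have hneg : Coprime₃ N (a₁ + (1 - p) * (a₂ - a₁)) (q * (a₂ - a₁)) ↔
      Coprime₃ N (a₁ + (1 - p) * (a₂ - a₁)) (-(q * (a₂ - a₁))) := by
    simp only [Coprime₃, Int.gcd_neg]
  rw [hneg]
  refine isMinimal_extension_iff hα hN (e := ((a₂ - a₁ : ℤ) : ZMod N)) hH fun x => ?_
  rw [stepFun_eq hζ0 hζ1, show (x : ℝ) - ζ = (x : ℝ) - q * α - p by rw [hζ]; ring,
    Int.floor_sub_intCast, hHx]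
  push_cast
  ring

theorem coprime₃_congr {a b c b' c' : ℤ} (h : ∀ k : ℤ, k ∣ b ∧ k ∣ c ↔ k ∣ b' ∧ k ∣ c') :
    Coprime₃ a b c ↔ Coprime₃ a b' c' := by
  simp only [coprime₃_iff, ← and_imp, h]

/-- Pairs of integers that are obtained from one another by integral linear combinations have
the same common divisors. -/
theorem coprime₃_congr_of_linear {a b c b' c' : ℤ} (x y z w x' y' z' w' : ℤ)
    (hb : b' = x * b + y * c) (hc : c' = z * b + w * c)
    (hb' : b = x' * b' + y' * c') (hc' : c = z' * b' + w' * c') :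
    Coprime₃ a b c ↔ Coprime₃ a b' c' := by
  refine coprime₃_congr fun k => ⟨fun ⟨h1, h2⟩ => ?_, fun ⟨h1, h2⟩ => ?_⟩
  · rw [hb, hc]
    exact ⟨dvd_add (h1.mul_left _) (h2.mul_left _), dvd_add (h1.mul_left _) (h2.mul_left _)⟩
  · rw [hb', hc']
    exact ⟨dvd_add (h1.mul_left _) (h2.mul_left _), dvd_add (h1.mul_left _) (h2.mul_left _)⟩

end VeechExt

theorem theorem6 (α : ℝ) (hα : Irrational α) (hα0 : 0 < α) (hα1 : α < 1)
    (N : ℕ) (hN : 2 ≤ N) (a₁ a₂ : ℤ) (ζ : ℝ) (hζ0 : 0 < ζ) (hζ1 : ζ < 1) (m : ℤ) :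
    (ζ = m * α →
      (VeechExt.IsMinimal (VeechExt.rotationExtension N α ζ a₁ a₂) ↔
        VeechExt.Coprime₃ N (m * a₁) a₂)) ∧
    (ζ = 1 - m * α →
      (VeechExt.IsMinimal (VeechExt.rotationExtension N α ζ a₁ a₂) ↔
        VeechExt.Coprime₃ N a₁ (m * a₂))) ∧
    (ζ = m * α - m + 1 →
      (VeechExt.IsMinimal (VeechExt.rotationExtension N α ζ a₁ a₂) ↔
        VeechExt.Coprime₃ N a₁ (m * a₂))) ∧
    (ζ = m - m * α →
      (VeechExt.IsMinimal (VeechExt.rotationExtension N α ζ a₁ a₂) ↔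
        VeechExt.Coprime₃ N (m * a₁) a₂)) ∧
    (ζ = 2 - m * α → 2 ≤ m → α < 1 / ((m : ℝ) - 1) →
      (VeechExt.IsMinimal (VeechExt.rotationExtension N α ζ a₁ a₂) ↔
        VeechExt.Coprime₃ N (a₂ + (m - 2) * a₁) (m * a₁))) ∧
    (ζ = m * α - 1 → 2 ≤ m → α < 1 / ((m : ℝ) - 1) →
      (VeechExt.IsMinimal (VeechExt.rotationExtension N α ζ a₁ a₂) ↔
        VeechExt.Coprime₃ N (a₁ + (m - 2) * a₂) (m * a₂))) := by
  have key := fun (p q : ℤ) (h : ζ = p + q * α) =>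
    VeechExt.isMinimal_rotationExtension_iff hα (by lia : 0 < N) a₁ a₂ hζ0 hζ1 h
  -- Each case reads off `(p, q)`; the eight coefficients are an integral 2×2 matrix and its inverse
  -- relating the two pairs.
  refine ⟨fun h => ?_, fun h => ?_, fun h => ?_, fun h => ?_, fun h _ _ => ?_, fun h _ _ => ?_⟩
  · rw [key 0 m (by rw [h]; push_cast; ring)]
    exact VeechExt.coprime₃_congr_of_linear (m) (-1) (1) (0) (0) (1) (-1) (m)
      (by ring) (by ring) (by ring) (by ring)
  · rw [key 1 (-m) (by rw [h]; push_cast; ring)]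
    exact VeechExt.coprime₃_congr_of_linear (1) (0) (m) (-1) (1) (0) (m) (-1)
      (by ring) (by ring) (by ring) (by ring)
  · rw [key (1 - m) m (by rw [h]; push_cast; ring)]
    exact VeechExt.coprime₃_congr_of_linear (1) (-1) (m) (1 - m) (1 - m) (1) (-m) (1)
      (by ring) (by ring) (by ring) (by ring)
  · rw [key m (-m) (by rw [h]; push_cast; ring)]
    exact VeechExt.coprime₃_congr_of_linear (m) (1 - m) (1) (-1) (1) (1-m) (1) (-m)
      (by ring) (by ring) (by ring) (by ring)
  · rw [key 2 (-m) (by rw [h]; push_cast; ring)]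
    exact VeechExt.coprime₃_congr_of_linear (m - 1) (-1) (m) (-1) (-1) (1) (-m) (m - 1)
      (by ring) (by ring) (by ring) (by ring)
  · rw [key (-1) m (by rw [h]; push_cast; ring)]
    exact VeechExt.coprime₃_congr_of_linear (m - 1) (-1) (m) (-1) (-1) (1) (-m) (m - 1)
      (by ring) (by ring) (by ring) (by ring)
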